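/- There is an absolute constant $K$ such that the following holds. Let $p$ be a prime, let $E$ be an elliptic curve over $\mathbb{F}_p$, and let $G=E(\mathbb{F}_p)$ be the abelian group of its $\mathbb{F}_p$-rational points, with operation $\oplus$, inversion $\ominus$ and identity $0_G$. Suppose that $n=|G|$ is odd. Then there is a subset $S\subset G$ with $S\cup\ominus S\cup\{0_G\}=G$ and $|S|=(n-1)/2$ such that the tournament $T_{p,n}(S)$ with vertex set $G$ and edge set $\{(x,y)\in G^2 : x\ominus y\in S\}$ satisfies $$C(T_{p,n}(S))\le \frac12\binom n2+K\,n^{3/2}(\log n)^2 .$$ Here, for a tournament $T$ with $n$ vertices, $C(T)=\max_\sigma C(T,\sigma)$, where $\sigma$ ranges over all bijections $V(T)\to\{1,\dots,n\}$ and $C(T,\sigma)$ is the number of edges $(x,y)$ of $T$ with $\sigma(x)<\sigma(y)$. -/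

import Mathlib

open scoped Pointwise

/-- A digraph is a tournament if it has no loops and any two distinct vertices `x`, `y` are joined
by exactly one of the edges `(x, y)`, `(y, x)`. -/
def IsTournament {V : Type*} (D : Digraph V) : Prop :=
  (∀ x, ¬ D.Adj x x) ∧ ∀ x y, x ≠ y → Xor (D.Adj x y) (D.Adj y x)

/-- `C(D, σ)`: the number of edges `(x, y)` of `D` that are consistent with the ranking `σ`,
that is, `σ x < σ y`. -/
noncomputable def consistentEdges {V : Type*} (D : Digraph V) (σ : V ≃ Fin (Nat.card V)) : ℕ :=
  {e : V × V | D.Adj e.1 e.2 ∧ σ e.1 < σ e.2}.ncard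

/-- `C(D)`: the maximum of `C(D, σ)` over all rankings `σ` of the vertices. -/
noncomputable def maxConsistentEdges {V : Type*} (D : Digraph V) : ℕ :=
  ⨆ σ : V ≃ Fin (Nat.card V), consistentEdges D σ

/-- On a finite vertex set the supremum is a maximum. -/
theorem isGreatest_maxConsistentEdges {V : Type*} [Finite V] (D : Digraph V) :
    IsGreatest (Set.range (consistentEdges D)) (maxConsistentEdges D) := by
  have hne : Nonempty (V ≃ Fin (Nat.card V)) := ⟨Finite.equivFin V⟩
  have hb : BddAbove (Set.range (consistentEdges D)) := (Set.finite_range _).bddAbove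
  exact ⟨Nat.sSup_mem (Set.range_nonempty _) hb, fun _ h => le_csSup hb h⟩

/-- The Cayley digraph of an additive group `G` with connection set `S`: its vertices are the
elements of `G` and its edges are the pairs `(x, y)` with `x - y ∈ S`. -/
def cayleyDigraph {G : Type*} [AddGroup G] (S : Set G) : Digraph G where
  Adj x y := x - y ∈ S

/-- If `S ∪ -S ∪ {0} = G` and `|S| = (|G| - 1) / 2`, with `|G|` odd, then the Cayley digraph of `S`
is a tournament. -/
theorem cayleyDigraph_isTournament {G : Type*} [AddGroup G] (hG : Odd (Nat.card G)) (S : Set G)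
    (hS : S ∪ -S ∪ {0} = Set.univ) (hcard : S.ncard = (Nat.card G - 1) / 2) :
    IsTournament (cayleyDigraph S) := by
  have hfin : Finite G := Nat.finite_of_card_ne_zero hG.pos.ne'
  have hneg : (-S).ncard = S.ncard := by
    rw [← Set.image_neg_eq_neg]; exact Set.ncard_image_of_injective S neg_injective
  have htot : (S ∪ -S ∪ {0}).ncard = Nat.card G := by rw [hS, Set.ncard_univ]
  obtain ⟨k, hk⟩ := hG
  have h1 := Set.ncard_union_le (S ∪ -S) {(0 : G)}
  rw [Set.ncard_singleton] at h1
  have h2 := Set.ncard_union_add_ncard_inter S (-S)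
  have h3 := Set.ncard_union_add_ncard_inter (S ∪ -S) {(0 : G)}
  rw [Set.ncard_singleton] at h3
  have h4 : (S ∩ -S).ncard = 0 := by omega
  have h5 : ((S ∪ -S) ∩ {0}).ncard = 0 := by omega
  rw [Set.ncard_eq_zero] at h4 h5
  have hzero : (0 : G) ∉ S := fun h => by
    have : (0 : G) ∈ (S ∪ -S) ∩ {0} := ⟨Or.inl h, rfl⟩
    simp [h5] at this
  refine ⟨fun x hx => hzero (by simpa [cayleyDigraph] using hx), fun x y hxy => ?_⟩
  have hmem : x - y ∈ S ∪ -S ∪ {0} := by rw [hS]; trivial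
  have hdis : ¬ (x - y ∈ S ∧ y - x ∈ S) := fun h => by
    have : x - y ∈ S ∩ -S := ⟨h.1, by simpa using h.2⟩
    simp [h4] at this
  have hor : x - y ∈ S ∨ y - x ∈ S := by
    rcases hmem with (h | h) | h
    · exact Or.inl h
    · exact Or.inr (by simpa using h)
    · exact absurd (sub_eq_zero.mp h) hxy
  change Xor (x - y ∈ S) (y - x ∈ S)
  unfold Xor
  tauto

/-!
The bound is proved for every finite abelian group `G` of odd order `n`, by the probabilistic
method, and then applied to the group of rational points.

Encode a tournament set `S` by the odd function `f = 1_S - 1_{-S}`, which is `±1` off `0`. For a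
ranking `σ` the number of consistent edges is `½ (n choose 2) + ½ ∑_{σ x < σ y} f (x - y)`, so the
last sum has to be small for every `σ`.

* If all Fourier coefficients of `f` are at most `lam` in norm, then Parseval gives
  `|∑_{a ∈ A, b ∈ B} f (a - b)| ≤ lam (|A| + |B|) / 2` for all `A`, `B`
  (`abs_sum_sum_sub_le`). Cutting the ranking dyadically into pairs of adjacent intervals decomposes
  `{σ x < σ y}` into `O(log n)` families of such rectangles, whence the sum is at most
  `O(log n) · lam · n` (`sum_interval_le`).
* A random choice of one element from each pair `{s, -s}` has all Fourier coefficients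
  `O(√(n log n))`, by an exponential moment bound and a union bound over the `n` characters
  (`exists_odd_sign_fourier_le`). The random choice is made by the method of conditional
  expectations (`exists_signs_sum_exp_le`).

Together these give an error `O(n^{3/2} (log n)^{3/2})`.
-/

/-! ### Choosing signs -/

/-- The average of `∑ i, w i * exp (∑ s ∈ P, ε s * c i s)` over all choices of signs `ε` is the
right-hand side; some choice of signs does at least as well as the average. -/
theorem exists_signs_sum_exp_le {ι α : Type*} [Fintype ι] [DecidableEq α] (c : ι → α → ℝ)
    (P : Finset α) : ∀ w : ι → ℝ, ∃ ε : α → ℝ, (∀ s, ε s = 1 ∨ ε s = -1) ∧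
      ∑ i, w i * Real.exp (∑ s ∈ P, ε s * c i s) ≤ ∑ i, w i * ∏ s ∈ P, Real.cosh (c i s) := by
  induction P using Finset.induction_on with
  | empty => exact fun w => ⟨fun _ => 1, fun _ => Or.inl rfl, by simp⟩
  | insert a P ha ih =>
    intro w
    obtain ⟨ε, hε, h⟩ := ih fun i => w i * Real.cosh (c i a)
    have key : ∀ e : ℝ, ∑ i, w i * Real.exp (∑ s ∈ insert a P, Function.update ε a e s * c i s) =
        ∑ i, w i * Real.exp (e * c i a) * Real.exp (∑ s ∈ P, ε s * c i s) := by
      intro e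
      refine Finset.sum_congr rfl fun i _ => ?_
      rw [Finset.sum_insert ha, Real.exp_add, Function.update_self, mul_assoc]
      congr 3
      refine Finset.sum_congr rfl fun s hs => ?_
      rw [Function.update_of_ne (by rintro rfl; exact ha hs)]
    have hsgn : ∀ e : ℝ, (e = 1 ∨ e = -1) → ∀ s, Function.update ε a e s = 1 ∨
        Function.update ε a e s = -1 := by
      intro e he s
      by_cases hs : s = a
      · subst hs; simpa using he
      · simpa [hs] using hε s
    have hR : ∑ i, w i * ∏ s ∈ insert a P, Real.cosh (c i s) =
        ∑ i, w i * Real.cosh (c i a) * ∏ s ∈ P, Real.cosh (c i s) :=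
      Finset.sum_congr rfl fun i _ => by rw [Finset.prod_insert ha, mul_assoc]
    have hsum : ∑ i, w i * Real.exp (1 * c i a) * Real.exp (∑ s ∈ P, ε s * c i s) +
        ∑ i, w i * Real.exp (-1 * c i a) * Real.exp (∑ s ∈ P, ε s * c i s) =
        2 * ∑ i, w i * Real.cosh (c i a) * Real.exp (∑ s ∈ P, ε s * c i s) := by
      rw [← Finset.sum_add_distrib, Finset.mul_sum]
      refine Finset.sum_congr rfl fun i _ => ?_
      rw [Real.cosh_eq, one_mul, neg_one_mul]
      ring
    rw [hR]
    by_cases h1 : ∑ i, w i * Real.exp (1 * c i a) * Real.exp (∑ s ∈ P, ε s * c i s) ≤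
        ∑ i, w i * Real.cosh (c i a) * ∏ s ∈ P, Real.cosh (c i s)
    · exact ⟨Function.update ε a 1, hsgn 1 (Or.inl rfl), (key 1).trans_le h1⟩
    · refine ⟨Function.update ε a (-1), hsgn (-1) (Or.inr rfl), (key (-1)).trans_le ?_⟩
      linarith

/-! ### An odd sign function with small Fourier coefficients -/

theorem eq_zero_of_eq_neg_of_odd_card {G : Type*} [AddCommGroup G] (hG : Odd (Nat.card G)) {x : G}
    (hx : x = -x) : x = 0 := by
  have h2 : (2 : ℕ) • x = 0 := by rw [two_nsmul]; nth_rw 1 [hx]; exact neg_add_cancel x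
  have hn : Nat.card G • x = 0 := card_nsmul_eq_zero'
  obtain ⟨k, hk⟩ := hG
  rw [hk, add_nsmul, mul_nsmul, h2] at hn
  simpa using hn

/-- On a group of odd order `n` there is an odd function, `±1` off `0`, all of whose Fourier
coefficients are `O(√(n log n))`. -/
theorem exists_odd_sign_fourier_le {G : Type*} [AddCommGroup G] [Fintype G]
    (hG : Odd (Nat.card G)) (h1 : 1 < Nat.card G) :
    ∃ f : G → ℝ, (∀ x, f (-x) = -f x) ∧ (∀ x, x ≠ 0 → f x = 1 ∨ f x = -1) ∧
      ∀ ψ : AddChar G ℂ, ‖∑ x, (f x : ℂ) * ψ x‖ ≤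
        3 * √(Nat.card G * Real.log (Nat.card G)) := by
  classical
  set n := Nat.card G with hn
  have hn1 : (1 : ℝ) < n := by exact_mod_cast h1
  have hlog : 0 < Real.log n := Real.log_pos hn1
  -- `P` picks one element from each pair `{s, -s}` with `s ≠ 0`.
  let e := Finite.equivFin G
  let P : Finset G := Finset.univ.filter fun s => e s < e (-s)
  have hP : ∀ s, s ∈ P ↔ e s < e (-s) := fun s => by simp [P]
  -- This `t` balances the two terms of the bound `(log n) / t + 2 t n`, up to a constant.
  set t : ℝ := √(Real.log n / n) with ht
  have htpos : 0 < t := Real.sqrt_pos.2 (by positivity)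
  have ht2 : t ^ 2 = Real.log n / n := Real.sq_sqrt (by positivity)
  obtain ⟨ε, hε, hle⟩ := exists_signs_sum_exp_le
    (fun (ψ : AddChar G ℂ) s => t * (2 * (ψ s).im)) P fun _ => 1
  let g : AddChar G ℂ → ℝ := fun ψ => ∑ s ∈ P, ε s * (2 * (ψ s).im)
  have hsum : ∑ ψ : AddChar G ℂ, Real.exp (t * g ψ) ≤ n * Real.exp (2 * t ^ 2 * n) := by
    have hexp : ∀ ψ : AddChar G ℂ,
        ∏ s ∈ P, Real.cosh (t * (2 * (ψ s).im)) ≤ Real.exp (2 * t ^ 2 * n) := by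
      intro ψ
      calc ∏ s ∈ P, Real.cosh (t * (2 * (ψ s).im)) ≤ ∏ s ∈ P, Real.exp (2 * t ^ 2) := by
            refine Finset.prod_le_prod (fun s _ => (Real.cosh_pos _).le) fun s _ => ?_
            refine (Real.cosh_le_exp_half_sq _).trans (Real.exp_le_exp.2 ?_)
            have him : |(ψ s).im| ≤ 1 := (Complex.abs_im_le_norm _).trans_eq (ψ.norm_apply s)
            have him2 : (ψ s).im ^ 2 ≤ 1 := (sq_le_one_iff_abs_le_one _).2 him
            nlinarith [sq_nonneg t]
        _ = Real.exp (2 * t ^ 2 * P.card) := by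
            rw [Finset.prod_const, ← Real.exp_nat_mul, mul_comm]
        _ ≤ Real.exp (2 * t ^ 2 * n) := by
            refine Real.exp_le_exp.2 (mul_le_mul_of_nonneg_left ?_ (by positivity))
            rw [hn, Nat.card_eq_fintype_card]
            exact_mod_cast Finset.card_le_univ P
    calc ∑ ψ : AddChar G ℂ, Real.exp (t * g ψ)
        = ∑ ψ : AddChar G ℂ, 1 * Real.exp (∑ s ∈ P, ε s * (t * (2 * (ψ s).im))) := by
          refine Finset.sum_congr rfl fun ψ _ => ?_
          rw [one_mul, Finset.mul_sum]
          congr 1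
          exact Finset.sum_congr rfl fun s _ => by ring
      _ ≤ ∑ ψ : AddChar G ℂ, 1 * ∏ s ∈ P, Real.cosh (t * (2 * (ψ s).im)) := hle
      _ ≤ ∑ ψ : AddChar G ℂ, Real.exp (2 * t ^ 2 * n) :=
          Finset.sum_le_sum fun ψ _ => by rw [one_mul]; exact hexp ψ
      _ = n * Real.exp (2 * t ^ 2 * n) := by
          rw [Finset.sum_const, Finset.card_univ, AddChar.card_eq, nsmul_eq_mul, hn,
            Nat.card_eq_fintype_card]
  have hg : ∀ ψ, g ψ ≤ 3 * √(n * Real.log n) := by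
    intro ψ
    have h := (Finset.single_le_sum (f := fun ψ => Real.exp (t * g ψ))
      (fun ψ _ => (Real.exp_pos _).le) (Finset.mem_univ ψ)).trans hsum
    have h' : t * g ψ ≤ 3 * Real.log n := by
      rw [← Real.exp_log (show (0 : ℝ) < n by linarith), ← Real.exp_add, Real.exp_le_exp,
        Real.exp_log (show (0 : ℝ) < n by linarith), ht2] at h
      have : 2 * (Real.log n / n) * n = 2 * Real.log n := by field_simp
      linarith
    have hprod : t * √(n * Real.log n) = Real.log n := by
      rw [ht, ← Real.sqrt_mul (by positivity),
        show Real.log n / n * (n * Real.log n) = Real.log n ^ 2 by field_simp,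
        Real.sqrt_sq hlog.le]
    refine le_of_mul_le_mul_left ?_ htpos
    linarith
  have hgneg : ∀ ψ, g ψ⁻¹ = -g ψ := by
    intro ψ
    simp only [g, ← Finset.sum_neg_distrib]
    refine Finset.sum_congr rfl fun s _ => ?_
    rw [AddChar.inv_apply, AddChar.map_neg_eq_conj, Complex.conj_im]
    ring
  let d : G → ℝ := fun x => if x ∈ P then ε x else 0
  refine ⟨fun x => d x - d (-x), fun x => by simp, fun x hx => ?_, fun ψ => ?_⟩
  · have hne : e x ≠ e (-x) := fun h => hx (eq_zero_of_eq_neg_of_odd_card hG (e.injective h))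
    simp only [d, hP, neg_neg]
    rcases lt_or_gt_of_ne hne with h | h
    · simpa [h, h.not_gt] using hε x
    · rcases hε (-x) with h' | h' <;> simp [h, h.not_gt, h']
  · have hF : ∑ x, ((d x - d (-x) : ℝ) : ℂ) * ψ x = g ψ * Complex.I := by
      have h2 : ∑ x, (d (-x) : ℂ) * ψ x = ∑ x, (d x : ℂ) * ψ (-x) :=
        Fintype.sum_equiv (Equiv.neg G) _ _ fun x => by simp
      simp only [Complex.ofReal_sub, sub_mul, Finset.sum_sub_distrib]
      rw [h2, ← Finset.sum_sub_distrib]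
      simp only [g, d, Complex.ofReal_sum, Finset.sum_mul]
      rw [← Finset.sum_filter_add_sum_filter_not Finset.univ (· ∈ P)]
      rw [Finset.sum_eq_zero (s := Finset.univ.filter fun x => x ∉ P)]
      · rw [add_zero, Finset.filter_mem_eq_inter, Finset.univ_inter]
        refine Finset.sum_congr rfl fun s hs => ?_
        rw [if_pos hs, AddChar.map_neg_eq_conj, ← mul_sub, Complex.sub_conj]
        push_cast
        ring
      · intro x hx
        simp [(Finset.mem_filter.1 hx).2]
    rw [hF, norm_mul, Complex.norm_I, mul_one, Complex.norm_real, Real.norm_eq_abs, abs_le]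
    have := hg ψ⁻¹
    rw [hgneg] at this
    exact ⟨by linarith, hg ψ⟩

/-! ### Sums over rectangles and over rankings -/

/-- Parseval's identity for the indicator function of a finite set. -/
theorem sum_norm_sq_sum_addChar {G : Type*} [AddCommGroup G] [Fintype G] (A : Finset G) :
    ∑ ψ : AddChar G ℂ, ‖∑ a ∈ A, ψ a‖ ^ 2 = Fintype.card G * A.card := by
  classical
  have h : ∀ ψ : AddChar G ℂ, ((‖∑ a ∈ A, ψ a‖ ^ 2 : ℝ) : ℂ) = ∑ a ∈ A, ∑ b ∈ A, ψ (a - b) := by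
    intro ψ
    push_cast
    rw [← Complex.mul_conj', map_sum, Finset.sum_mul_sum]
    refine Finset.sum_congr rfl fun a _ => Finset.sum_congr rfl fun b _ => ?_
    rw [← AddChar.map_neg_eq_conj, ← AddChar.map_add_eq_mul, sub_eq_add_neg]
  apply Complex.ofReal_injective
  rw [Complex.ofReal_sum, Finset.sum_congr rfl fun ψ _ => h ψ, Finset.sum_comm]
  simp_rw [Finset.sum_comm (s := Finset.univ), AddChar.sum_apply_eq_ite, sub_eq_zero]
  simp [mul_comm]

theorem abs_sum_sum_sub_le {G : Type*} [AddCommGroup G] [Fintype G] {f : G → ℝ} {lam : ℝ}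
    (hf : ∀ ψ : AddChar G ℂ, ‖∑ x, (f x : ℂ) * ψ x‖ ≤ lam) (A B : Finset G) :
    |∑ a ∈ A, ∑ b ∈ B, f (a - b)| ≤ lam * (A.card + B.card) / 2 := by
  classical
  have hcard : (0 : ℝ) < Fintype.card G := by exact_mod_cast Fintype.card_pos
  have hinv : ∀ z : G, ∑ ψ : AddChar G ℂ, (∑ x, (f x : ℂ) * ψ x) * ψ (-z) =
      Fintype.card G * f z := by
    intro z
    simp_rw [Finset.sum_mul, mul_assoc, ← AddChar.map_add_eq_mul]
    rw [Finset.sum_comm]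
    simp_rw [← Finset.mul_sum, AddChar.sum_apply_eq_ite, ← sub_eq_add_neg, sub_eq_zero]
    simp [mul_comm]
  have hrep : ((Fintype.card G * ∑ a ∈ A, ∑ b ∈ B, f (a - b) : ℝ) : ℂ) =
      ∑ ψ : AddChar G ℂ, (∑ x, (f x : ℂ) * ψ x) *
        ((starRingEnd ℂ) (∑ a ∈ A, ψ a) * ∑ b ∈ B, ψ b) := by
    push_cast
    rw [Finset.mul_sum, Finset.sum_congr rfl fun a _ => Finset.mul_sum _ _ _]
    simp_rw [← hinv]
    rw [Finset.sum_congr rfl fun a _ => Finset.sum_comm, Finset.sum_comm]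
    refine Finset.sum_congr rfl fun ψ _ => ?_
    rw [map_sum, Finset.sum_mul_sum, Finset.mul_sum]
    refine Finset.sum_congr rfl fun a _ => ?_
    rw [Finset.mul_sum]
    refine Finset.sum_congr rfl fun b _ => ?_
    rw [← AddChar.map_neg_eq_conj, ← AddChar.map_add_eq_mul, neg_sub, sub_eq_neg_add]
  have hbound : Fintype.card G * |∑ a ∈ A, ∑ b ∈ B, f (a - b)| ≤
      ∑ ψ : AddChar G ℂ, lam * ((‖∑ a ∈ A, ψ a‖ ^ 2 + ‖∑ b ∈ B, ψ b‖ ^ 2) / 2) := by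
    rw [← abs_of_pos hcard, ← abs_mul, ← Real.norm_eq_abs, ← Complex.norm_real,
      hrep]
    refine (norm_sum_le _ _).trans (Finset.sum_le_sum fun ψ _ => ?_)
    rw [norm_mul, norm_mul, RCLike.norm_conj]
    refine mul_le_mul (hf ψ) ?_ (by positivity) ((norm_nonneg _).trans (hf ψ))
    linarith [two_mul_le_add_sq ‖∑ a ∈ A, ψ a‖ ‖∑ b ∈ B, ψ b‖]
  rw [← Finset.mul_sum, ← Finset.sum_div, Finset.sum_add_distrib, sum_norm_sq_sum_addChar,
    sum_norm_sq_sum_addChar] at hbound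
  refine le_of_mul_le_mul_left (hbound.trans_eq ?_) hcard
  ring

/-- Dyadic decomposition: if sums of `h` over rectangles `A × B` are at most `lam (|A| + |B|) / 2`,
then the sum over the correctly ordered pairs from an interval `I` of `2 ^ k` ranks is at most
`k lam |I| / 2`. Each halving of the interval contributes one rectangle. -/
theorem sum_interval_le {V : Type*} [Fintype V] {r : V → ℕ}
    {h : V → V → ℝ} {lam : ℝ}
    (hrect : ∀ A B : Finset V, ∑ a ∈ A, ∑ b ∈ B, h a b ≤ lam * (A.card + B.card) / 2) (k : ℕ) :
    ∀ m : ℕ, ∑ x with m ≤ r x ∧ r x < m + 2 ^ k, ∑ y with m ≤ r y ∧ r y < m + 2 ^ k,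
      (if r x < r y then h x y else 0) ≤
        k * (lam * (Finset.univ.filter fun x => m ≤ r x ∧ r x < m + 2 ^ k).card / 2) := by
  classical
  induction k with
  | zero =>
    intro m
    simp only [Nat.cast_zero, zero_mul]
    refine (Finset.sum_eq_zero fun x hx => Finset.sum_eq_zero fun y hy => if_neg ?_).le
    simp only [Finset.mem_filter, Finset.mem_univ, true_and, pow_zero] at hx hy
    omega
  | succ k ih =>
    intro m
    set A : Finset V := Finset.univ.filter fun x => m ≤ r x ∧ r x < m + 2 ^ k with hA
    set B : Finset V := Finset.univ.filter fun x => m + 2 ^ k ≤ r x ∧ r x < m + 2 ^ k + 2 ^ k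
      with hB
    have hAB : (Finset.univ.filter fun x => m ≤ r x ∧ r x < m + 2 ^ (k + 1)) = A ∪ B := by
      ext x
      simp only [hA, hB, Finset.mem_filter, Finset.mem_univ, true_and, Finset.mem_union, pow_succ]
      omega
    have hdis : Disjoint A B := by
      rw [Finset.disjoint_left]
      intro x hx hy
      simp only [hA, hB, Finset.mem_filter, Finset.mem_univ, true_and] at hx hy
      omega
    have hcross : ∑ x ∈ A, ∑ y ∈ B, (if r x < r y then h x y else 0) =
        ∑ x ∈ A, ∑ y ∈ B, h x y := by
      refine Finset.sum_congr rfl fun x hx => Finset.sum_congr rfl fun y hy => if_pos ?_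
      simp only [hA, hB, Finset.mem_filter, Finset.mem_univ, true_and] at hx hy
      omega
    have hcross' : ∑ x ∈ B, ∑ y ∈ A, (if r x < r y then h x y else 0) = 0 := by
      refine Finset.sum_eq_zero fun x hx => Finset.sum_eq_zero fun y hy => if_neg ?_
      simp only [hA, hB, Finset.mem_filter, Finset.mem_univ, true_and] at hx hy
      omega
    rw [hAB, Finset.sum_union hdis, Finset.card_union_of_disjoint hdis]
    simp_rw [Finset.sum_union hdis, Finset.sum_add_distrib]
    rw [hcross, hcross']
    have h1 := ih m
    have h2 := ih (m + 2 ^ k)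
    rw [← hA] at h1
    rw [← hB] at h2
    have h3 := hrect A B
    push_cast
    linarith

/-! ### The Cayley tournament -/

theorem sum_ranking_lt {V : Type*} [Fintype V] {r : V → ℕ} (hr : Function.Injective r) :
    ∑ x, ∑ y, (if r x < r y then (1 : ℝ) else 0) = (Nat.card V).choose 2 := by
  classical
  have h : ∑ x : V, ∑ y : V, ((if r x < r y then (1 : ℝ) else 0) + (if r y < r x then 1 else 0) +
      if x = y then 1 else 0) = ∑ x : V, ∑ y : V, 1 := by
    refine Finset.sum_congr rfl fun x _ => Finset.sum_congr rfl fun y _ => ?_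
    rcases lt_trichotomy (r x) (r y) with h | h | h
    · simp [h, h.not_gt, show x ≠ y by rintro rfl; exact h.false]
    · simp [hr h]
    · simp [h, h.not_gt, show x ≠ y by rintro rfl; exact h.false]
  simp only [Finset.sum_add_distrib] at h
  rw [Finset.sum_comm (f := fun x y : V => if r y < r x then (1 : ℝ) else 0)] at h
  simp only [Finset.sum_ite_eq, Finset.mem_univ, if_true, Finset.sum_const, nsmul_eq_mul, mul_one,
    Finset.card_univ] at h
  rw [Nat.card_eq_fintype_card, Nat.cast_choose_two]
  linarith

/-- The number of consistent edges of the Cayley tournament attached to an odd sign function. -/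
theorem consistentEdges_cayleyDigraph_eq {G : Type*} [AddCommGroup G] [Fintype G] {f : G → ℝ}
    (hf : ∀ x, x ≠ 0 → f x = 1 ∨ f x = -1) (σ : G ≃ Fin (Nat.card G)) :
    (consistentEdges (cayleyDigraph {x | f x = 1}) σ : ℝ) =
      1 / 2 * ((Nat.card G).choose 2 : ℝ) +
        1 / 2 * ∑ x, ∑ y, if (σ x : ℕ) < σ y then f (x - y) else 0 := by
  classical
  have hr : Function.Injective fun x => (σ x : ℕ) := Fin.val_injective.comp σ.injective
  have hset : {e : G × G | (cayleyDigraph {x | f x = 1}).Adj e.1 e.2 ∧ σ e.1 < σ e.2} =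
      ((Finset.univ.filter fun e : G × G => f (e.1 - e.2) = 1 ∧ (σ e.1 : ℕ) < σ e.2 :
        Finset (G × G)) : Set (G × G)) := by
    ext e
    simp [cayleyDigraph]
  rw [consistentEdges, hset, Set.ncard_coe_finset, ← sum_ranking_lt hr,
    Finset.card_filter, Nat.cast_sum, Fintype.sum_prod_type, Finset.mul_sum, Finset.mul_sum,
    ← Finset.sum_add_distrib]
  refine Finset.sum_congr rfl fun x _ => ?_
  rw [Finset.mul_sum, Finset.mul_sum, ← Finset.sum_add_distrib]
  refine Finset.sum_congr rfl fun y _ => ?_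
  by_cases hxy : (σ x : ℕ) < σ y
  · have hne : x - y ≠ 0 := fun h => by rw [sub_eq_zero.1 h] at hxy; exact hxy.false
    rcases hf _ hne with h | h <;> norm_num [h, hxy]
  · simp [hxy]

theorem exists_cayley_tournament_maxConsistentEdges_le {G : Type*} [AddCommGroup G]
    (hG : Odd (Nat.card G)) :
    ∃ S : Set G, S ∪ -S ∪ {0} = Set.univ ∧ S.ncard = (Nat.card G - 1) / 2 ∧
      (maxConsistentEdges (cayleyDigraph S) : ℝ) ≤ 1 / 2 * ((Nat.card G).choose 2 : ℝ) +
        3 * ((Nat.card G : ℝ) ^ (3 / 2 : ℝ) * Real.log (Nat.card G) ^ 2) := by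
  classical
  have hfin : Finite G := Nat.finite_of_card_ne_zero hG.pos.ne'
  have := Fintype.ofFinite G
  rcases Nat.lt_or_eq_of_le (Nat.succ_le_of_lt hG.pos) with h1 | h1
  swap
  · have hsub : Subsingleton G := (Nat.card_eq_one_iff_unique.1 h1.symm).1
    refine ⟨∅, ?_, by rw [← h1]; simp, ?_⟩
    · ext x
      simp [Subsingleton.elim x 0]
    · obtain ⟨⟨σ, hσ⟩, -⟩ := isGreatest_maxConsistentEdges (cayleyDigraph (∅ : Set G))
      rw [← hσ, consistentEdges]
      simp only [cayleyDigraph, Set.mem_empty_iff_false, false_and, Set.ofPred_false,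
        Set.ncard_empty, Nat.cast_zero]
      positivity
  obtain ⟨f, hodd, hsgn, hfour⟩ := exists_odd_sign_fourier_le hG h1
  set n := Nat.card G with hn
  have hf0 : f 0 = 0 := by
    have := hodd 0
    rw [neg_zero] at this
    linarith
  have hunion : {x | f x = 1} ∪ -{x | f x = 1} ∪ {0} = Set.univ := by
    ext x
    simp only [Set.mem_union, Set.mem_ofPred_eq, Set.mem_neg, Set.mem_singleton_iff, Set.mem_univ,
      iff_true, hodd]
    by_cases hx : x = 0
    · exact Or.inr hx
    · rcases hsgn x hx with h | h
      · exact Or.inl (Or.inl h)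
      · exact Or.inl (Or.inr (by rw [h, neg_neg]))
  refine ⟨{x | f x = 1}, hunion, ?_, ?_⟩
  · have hd1 : Disjoint {x | f x = 1} (-{x | f x = 1}) := by
      rw [Set.disjoint_left]
      intro x hx hy
      simp only [Set.mem_ofPred_eq, Set.mem_neg, hodd] at hx hy
      linarith
    have hd2 : Disjoint ({x | f x = 1} ∪ -{x | f x = 1}) {0} := by
      rw [Set.disjoint_singleton_right]
      simp [hf0]
    have hneg : (-{x | f x = 1}).ncard = {x | f x = 1}.ncard := by
      rw [← Set.image_neg_eq_neg]; exact Set.ncard_image_of_injective _ neg_injective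
    have hc := congrArg Set.ncard hunion
    rw [Set.ncard_union_eq hd2, Set.ncard_union_eq hd1, hneg, Set.ncard_singleton,
      Set.ncard_univ] at hc
    omega
  · obtain ⟨⟨σ, hσ⟩, -⟩ := isGreatest_maxConsistentEdges (cayleyDigraph {x | f x = 1})
    rw [← hσ, consistentEdges_cayleyDigraph_eq hsgn]
    have hn3 : 3 ≤ n := by obtain ⟨k, hk⟩ := hG; omega
    have hn3' : (3 : ℝ) ≤ n := by exact_mod_cast hn3
    have hlog : 1 ≤ Real.log n := by
      rw [Real.le_log_iff_exp_le (by linarith)]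
      linarith [Real.exp_one_lt_three]
    set k := Nat.log 2 n + 1 with hk
    have hkn : n < 2 ^ k := Nat.lt_pow_succ_log_self (by norm_num) n
    have hklog : (k : ℝ) ≤ 3 * Real.log n := by
      have hl : (Nat.log 2 n : ℝ) ≤ Real.logb 2 n := Real.natLog_le_logb n 2
      have h2 : Real.logb 2 n ≤ 2 * Real.log n := by
        rw [Real.logb, div_le_iff₀ (Real.log_pos (by norm_num))]
        nlinarith [Real.log_two_gt_d9]
      rw [hk]
      push_cast
      linarith
    have huniv : (Finset.univ.filter fun x : G => 0 ≤ (σ x : ℕ) ∧ (σ x : ℕ) < 0 + 2 ^ k) =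
        Finset.univ :=
      Finset.filter_true_of_mem fun x _ => ⟨Nat.zero_le _, by have := (σ x).isLt; omega⟩
    have hmain := sum_interval_le (r := fun x => (σ x : ℕ)) (h := fun x y => f (x - y))
      (fun A B => (le_abs_self _).trans (abs_sum_sum_sub_le hfour A B)) k 0
    simp only [huniv, Finset.card_univ, ← Nat.card_eq_fintype_card, ← hn] at hmain
    have hsqrt : (n : ℝ) * √(n * Real.log n) ≤ (n : ℝ) ^ (3 / 2 : ℝ) * Real.log n := by
      rw [Real.sqrt_mul (by positivity), ← mul_assoc, show (3 / 2 : ℝ) = 1 + 1 / 2 by norm_num,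
        Real.rpow_add (by positivity), Real.rpow_one, ← Real.sqrt_eq_rpow]
      refine mul_le_mul_of_nonneg_left ?_ (by positivity)
      exact Real.sqrt_le_iff.2 ⟨by linarith, by nlinarith⟩
    have hfin' : (k : ℝ) * (n * √(n * Real.log n)) ≤
        3 * Real.log n * ((n : ℝ) ^ (3 / 2 : ℝ) * Real.log n) :=
      mul_le_mul hklog hsqrt (by positivity) (by positivity)
    have hpos : 0 ≤ (n : ℝ) ^ (3 / 2 : ℝ) * Real.log n ^ 2 := by positivity
    linarith

theorem corollary4p8 :
    ∃ K : ℝ, ∀ (p : ℕ) [Fact p.Prime] (E : WeierstrassCurve (ZMod p)) [E.IsElliptic] (n : ℕ),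
      Nat.card E.toAffine.Point = n → Odd n →
        ∃ S : Set E.toAffine.Point,
          S ∪ -S ∪ {0} = Set.univ ∧ S.ncard = (n - 1) / 2 ∧
          (maxConsistentEdges (cayleyDigraph S) : ℝ) ≤
            1 / 2 * (n.choose 2 : ℝ) + K * ((n : ℝ) ^ (3 / 2 : ℝ) * Real.log n ^ 2) := by
  refine ⟨3, fun p _ E _ n hn hodd => ?_⟩
  subst hn
  exact exists_cayley_tournament_maxConsistentEdges_le hodd
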